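/- Work classically in a universe $V$ of sets, with class $\mathrm{ORD}$ of ordinals. Define the class $\mathbf M$ of Kripke sets inductively: a Kripke set is a function $f$ assigning to each $\kappa\in\mathrm{ORD}$ a set $f(\kappa)$ of previously defined Kripke sets, such that $f$ is monotonically non-decreasing ($\kappa<\lambda$ implies $f(\kappa)\subseteq f(\lambda)$) and eventually constant ($\exists\kappa\,\forall\lambda>\kappa\; f(\lambda)=f(\kappa)$). Regard $\mathbf M$ as a Kripke model for the language $\{\in,=\}$ whose partial order of nodes is $\mathrm{ORD}$, whose universe at every node is $\mathbf M$, whose transition functions are identities, and whose atomic relations are given recursively by $$\kappa\models f\in g \iff \exists h\in g(\kappa)\;\; \kappa\models f=h,$$ $$\kappa\models f=g \iff \forall\lambda\ge\kappa\;\bigl[\forall h\in f(\lambda)\;\lambda\models h\in g\ \text{ and }\ \forall h\in g(\lambda)\;\lambda\models h\in f\bigr];$$ forcing of compound formulas is given by the usual (intuitionistic) Kripke clauses, and $\mathbf M\models\varphi$ means that every node forces $\varphi$. Let CZF consist of Extensionality, Empty Set, Pairing, Union, Strong Infinity (there is a least inductive set), Set Induction, $\Delta_0$ Separation, Strong Collection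 and Subset Collection. Reflection is the scheme asserting, for each formula $\varphi(x_1,\dots,x_n)$, that for every set $b$ there is a transitive set $a\supseteq b$ such that $\forall x_1,\dots,x_n\in a\;(\varphi(\vec x)\leftrightarrow\varphi^a(\vec x))$, where $\varphi^a$ is $\varphi$ with all quantifiers bounded by $a$. Then $\mathbf M$ satisfies the axioms of equality, all axioms of CZF, and the full Separation scheme, but not Reflection. In fact, for the sentence $$\psi:\quad \neg\,\forall x\,\forall y\,(x=y\vee \neg\, x=y)$$ we have $\mathbf M\models\psi$ and $\mathbf M\models\forall a\,\neg\psi^a$ (that is, $\psi$ is true in the whole model, and false when relativized to any set); and $\mathbf M$ satisfies the negation of the instance of Reflection for $\psi$. -/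

import Mathlib

universe u

namespace KripkeCZF

/-! ## First-order formulas in the language with `∈` and `=` -/

/-- `Fml n`: formulas of set theory with free variables among `0, …, n - 1` (de Bruijn indices: a
quantifier binds variable `0` of its body and shifts the others up by one).  All intuitionistic
connectives are primitive. -/
inductive Fml : ℕ → Type
  | bot {n : ℕ} : Fml n
  | mem {n : ℕ} (i j : Fin n) : Fml n
  | eq {n : ℕ} (i j : Fin n) : Fml n
  | and {n : ℕ} (φ ψ : Fml n) : Fml n
  | or {n : ℕ} (φ ψ : Fml n) : Fml n
  | imp {n : ℕ} (φ ψ : Fml n) : Fml n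
  | all {n : ℕ} (φ : Fml (n + 1)) : Fml n
  | ex {n : ℕ} (φ : Fml (n + 1)) : Fml n

namespace Fml

def neg {n : ℕ} (φ : Fml n) : Fml n := imp φ bot

def iff {n : ℕ} (φ ψ : Fml n) : Fml n := and (imp φ ψ) (imp ψ φ)

/-- `∀ x ∈ t, φ`; in `φ` the variable `x` has index `0`. -/
def ball {n : ℕ} (t : Fin n) (φ : Fml (n + 1)) : Fml n := all (imp (mem 0 t.succ) φ)

/-- `∃ x ∈ t, φ`; in `φ` the variable `x` has index `0`. -/
def bex {n : ℕ} (t : Fin n) (φ : Fml (n + 1)) : Fml n := ex (and (mem 0 t.succ) φ)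

/-- Renaming of the free variables along `r`. -/
def rename : {n m : ℕ} → (Fin n → Fin m) → Fml n → Fml m
  | _, _, _, bot => bot
  | _, _, r, mem i j => mem (r i) (r j)
  | _, _, r, eq i j => eq (r i) (r j)
  | _, _, r, and φ ψ => and (rename r φ) (rename r ψ)
  | _, _, r, or φ ψ => or (rename r φ) (rename r ψ)
  | _, _, r, imp φ ψ => imp (rename r φ) (rename r ψ)
  | _, _, r, all φ => all (rename (Fin.cons 0 (fun i => (r i).succ)) φ)
  | _, _, r, ex φ => ex (rename (Fin.cons 0 (fun i => (r i).succ)) φ)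

/-- Universal closure. -/
def close : {n : ℕ} → Fml n → Fml 0
  | 0, φ => φ
  | _ + 1, φ => close (all φ)

/-- The relativization of `φ` to (the set denoted by) the variable `t`: every quantifier is bounded
by `t`. -/
def relTo : {n : ℕ} → Fin n → Fml n → Fml n
  | _, _, bot => bot
  | _, _, mem i j => mem i j
  | _, _, eq i j => eq i j
  | _, t, and φ ψ => and (relTo t φ) (relTo t ψ)
  | _, t, or φ ψ => or (relTo t φ) (relTo t ψ)
  | _, t, imp φ ψ => imp (relTo t φ) (relTo t ψ)
  | _, t, all φ => ball t (relTo t.succ φ)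
  | _, t, ex φ => bex t (relTo t.succ φ)

/-- `Δ₀` formulas: all quantifiers are bounded. -/
inductive IsDelta0 : {n : ℕ} → Fml n → Prop
  | bot {n : ℕ} : IsDelta0 (bot : Fml n)
  | mem {n : ℕ} (i j : Fin n) : IsDelta0 (mem i j)
  | eq {n : ℕ} (i j : Fin n) : IsDelta0 (eq i j)
  | and {n : ℕ} {φ ψ : Fml n} : IsDelta0 φ → IsDelta0 ψ → IsDelta0 (and φ ψ)
  | or {n : ℕ} {φ ψ : Fml n} : IsDelta0 φ → IsDelta0 ψ → IsDelta0 (or φ ψ)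
  | imp {n : ℕ} {φ ψ : Fml n} : IsDelta0 φ → IsDelta0 ψ → IsDelta0 (imp φ ψ)
  | ball {n : ℕ} (t : Fin n) {φ : Fml (n + 1)} : IsDelta0 φ → IsDelta0 (ball t φ)
  | bex {n : ℕ} (t : Fin n) {φ : Fml (n + 1)} : IsDelta0 φ → IsDelta0 (bex t φ)

/-! ## The axioms -/

/-- `∀ x, x = x`. -/
def eqRefl : Fml 0 := all (eq 0 0)

/-- `∀ x y, x = y → y = x`. -/
def eqSymm : Fml 0 := all (all (imp (eq 1 0) (eq 0 1)))

/-- `∀ x y z, x = y ∧ y = z → x = z`. -/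
def eqTrans : Fml 0 := all (all (all (imp (and (eq 2 1) (eq 1 0)) (eq 2 0))))

/-- `∀ x y z, x = y ∧ x ∈ z → y ∈ z`. -/
def eqMemLeft : Fml 0 := all (all (all (imp (and (eq 2 1) (mem 2 0)) (mem 1 0))))

/-- `∀ x y z, x = y ∧ z ∈ x → z ∈ y`. -/
def eqMemRight : Fml 0 := all (all (all (imp (and (eq 2 1) (mem 0 2)) (mem 0 1))))

/-- `∀ x y, x = y ↔ ∀ z, z ∈ x ↔ z ∈ y`. -/
def extensionality : Fml 0 :=
  all (all (iff (eq 1 0) (all (iff (mem 0 2) (mem 0 1)))))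

/-- `∃ x, ∀ y, ¬ y ∈ x`. -/
def emptySet : Fml 0 := ex (all (neg (mem 0 1)))

/-- `∀ x y, ∃ z, ∀ w, w ∈ z ↔ w = x ∨ w = y`. -/
def pairing : Fml 0 :=
  all (all (ex (all (iff (mem 0 1) (or (eq 0 3) (eq 0 2))))))

/-- `∀ x, ∃ z, ∀ w, w ∈ z ↔ ∃ y ∈ x, w ∈ y`. -/
def union : Fml 0 :=
  all (ex (all (iff (mem 0 1) (bex 2 (mem 1 0)))))

/-- `t` is inductive: `(∃ e ∈ t, ∀ y, ¬ y ∈ e) ∧ ∀ k ∈ t, ∃ m ∈ t, ∀ y, y ∈ m ↔ y ∈ k ∨ y = k`. -/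
def isInductive {n : ℕ} (t : Fin n) : Fml n :=
  and (bex t (all (neg (mem 0 1))))
    (ball t (bex t.succ (all (iff (mem 0 1) (or (mem 0 2) (eq 0 2))))))

/-- `∃ a, a is inductive ∧ ∀ b, b is inductive → ∀ x ∈ a, x ∈ b`. -/
def strongInfinity : Fml 0 :=
  ex (and (isInductive 0) (all (imp (isInductive 0) (ball 1 (mem 0 1)))))

/-- For `φ(x, p)` (with `x` variable `0`):
`∀ p, (∀ x, (∀ y ∈ x, φ(y, p)) → φ(x, p)) → ∀ x, φ(x, p)`. -/
def setInduction {n : ℕ} (φ : Fml (n + 1)) : Fml 0 :=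
  close (imp
    (all (imp (ball 0 (φ.rename (Fin.cons 0 (fun i => i.addNat 2)))) φ))
    (all φ))

/-- For `φ(x, p)` (with `x` variable `0`): `∀ p, ∀ a, ∃ b, ∀ x, x ∈ b ↔ x ∈ a ∧ φ(x, p)`. -/
def separation {n : ℕ} (φ : Fml (n + 1)) : Fml 0 :=
  close (all (ex (all (iff (mem 0 1)
    (and (mem 0 2) (φ.rename (Fin.cons 0 (fun i => i.addNat 3))))))))

/-- For `φ(y, x, p)` (with `y`, `x` variables `0`, `1`): `∀ p, ∀ a, (∀ x ∈ a, ∃ y, φ) →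
∃ b, (∀ x ∈ a, ∃ y ∈ b, φ) ∧ (∀ y ∈ b, ∃ x ∈ a, φ)`. -/
def strongCollection {n : ℕ} (φ : Fml (n + 2)) : Fml 0 :=
  close (all (imp
    (ball 0 (ex (φ.rename (Fin.cons 0 (Fin.cons 1 (fun i => i.addNat 3))))))
    (ex (and
      (ball 1 (bex 1 (φ.rename (Fin.cons 0 (Fin.cons 1 (fun i => i.addNat 4))))))
      (ball 0 (bex 2 (φ.rename (Fin.cons 1 (Fin.cons 0 (fun i => i.addNat 4))))))))))

/-- For `φ(y, x, u, p)` (with `y`, `x`, `u` variables `0`, `1`, `2`):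
`∀ p, ∀ a b, ∃ c, ∀ u, (∀ x ∈ a, ∃ y ∈ b, φ) →
∃ d ∈ c, (∀ x ∈ a, ∃ y ∈ d, φ) ∧ (∀ y ∈ d, ∃ x ∈ a, φ)`. -/
def subsetCollection {n : ℕ} (φ : Fml (n + 3)) : Fml 0 :=
  close (all (all (ex (all (imp
    (ball 3 (bex 3 (φ.rename
      (Fin.cons 0 (Fin.cons 1 (Fin.cons 2 (fun i => i.addNat 6)))))))
    (bex 1 (and
      (ball 4 (bex 1 (φ.rename
        (Fin.cons 0 (Fin.cons 1 (Fin.cons 3 (fun i => i.addNat 7)))))))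
      (ball 0 (bex 5 (φ.rename
        (Fin.cons 1 (Fin.cons 0 (Fin.cons 3 (fun i => i.addNat 7))))))))))))))

/-- `∀ x₀ ∈ t, …, ∀ xₖ₋₁ ∈ t, χ`, where the `xᵢ` are the variables `0, …, k - 1` of `χ`. -/
def ballN {m : ℕ} (t : Fin m) : (k : ℕ) → Fml (m + k) → Fml m
  | 0, χ => χ
  | k + 1, χ => ballN t k (ball (t.addNat k) χ)

/-- The instance of Reflection for `φ(x₀, …, xₖ₋₁)`: every set `b` is a subset of some transitive
set `a` with `∀ x₀ ∈ a, …, ∀ xₖ₋₁ ∈ a, φ ↔ φᵃ`, where `φᵃ` is `φ` relativized to `a`. -/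
def reflection {k : ℕ} (φ : Fml k) : Fml 0 :=
  all (ex (and (ball 1 (mem 0 1)) (and
    (ball 0 (ball 0 (mem 0 2)))
    (ballN 0 k (iff
      (φ.rename (Fin.castLE (Nat.le_add_left k 2)))
      ((φ.rename (Fin.castLE (Nat.le_add_left k 2))).relTo ((0 : Fin 2).addNat k)))))))

/-- The axioms of equality. -/
inductive EqualityAxiom : Fml 0 → Prop
  | eqRefl : EqualityAxiom eqRefl
  | eqSymm : EqualityAxiom eqSymm
  | eqTrans : EqualityAxiom eqTrans
  | eqMemLeft : EqualityAxiom eqMemLeft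
  | eqMemRight : EqualityAxiom eqMemRight

/-- The axioms of constructive Zermelo–Fraenkel set theory CZF. -/
inductive CZF : Fml 0 → Prop
  | extensionality : CZF extensionality
  | emptySet : CZF emptySet
  | pairing : CZF pairing
  | union : CZF union
  | strongInfinity : CZF strongInfinity
  | setInduction {n : ℕ} (φ : Fml (n + 1)) : CZF (setInduction φ)
  | restrictedSeparation {n : ℕ} (φ : Fml (n + 1)) (hφ : IsDelta0 φ) : CZF (separation φ)
  | strongCollection {n : ℕ} (φ : Fml (n + 2)) : CZF (strongCollection φ)
  | subsetCollection {n : ℕ} (φ : Fml (n + 3)) : CZF (subsetCollection φ)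

/-- The sentence `¬ ∀ x y, x = y ∨ ¬ x = y`. -/
def notDecEq : Fml 0 := neg (all (all (or (eq 1 0) (neg (eq 1 0)))))

end Fml

/-! ## The Kripke sets

The nodes are all ordinals of the universe `Type u`, which plays the role of the class of sets. -/

/-- Functions `f` from the ordinals to sets (small families) of previously built such functions. -/
inductive PreKSet : Type (u + 1)
  | mk (I : Ordinal.{u} → Type u) (elt : (σ : Ordinal.{u}) → I σ → PreKSet) : PreKSet

namespace PreKSet

/-- `f.val σ` is the set `f(σ)`. -/
def val : PreKSet.{u} → Ordinal.{u} → Set PreKSet.{u}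
  | mk _ elt, σ => Set.range (elt σ)

/-- Hereditarily, `f` is monotonically non-decreasing and eventually constant. -/
def IsKripke : PreKSet.{u} → Prop
  | mk I elt =>
    (∀ (σ : Ordinal.{u}) (i : I σ), IsKripke (elt σ i)) ∧
    (∀ σ τ : Ordinal.{u}, σ < τ → Set.range (elt σ) ⊆ Set.range (elt τ)) ∧
    (∃ κ : Ordinal.{u}, ∀ τ : Ordinal.{u}, κ < τ → Set.range (elt τ) = Set.range (elt κ))

/-- `σ ⊨ f = g`: for all `τ ≥ σ`, every `h ∈ f(τ)` is forced at `τ` to be equal to some element of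
`g(τ)`, that is, to be a member of `g`, and vice versa (see `eqAt_iff`). -/
def EqAt : PreKSet.{u} → PreKSet.{u} → Ordinal.{u} → Prop
  | mk I f, mk J g, σ => ∀ τ : Ordinal.{u}, σ ≤ τ →
      (∀ i : I τ, ∃ j : J τ, EqAt (f τ i) (g τ j) τ) ∧
      (∀ j : J τ, ∃ i : I τ, EqAt (f τ i) (g τ j) τ)

/-- `σ ⊨ f ∈ g`: some `h ∈ g(σ)` has `σ ⊨ f = h`. -/
def MemAt (f g : PreKSet.{u}) (σ : Ordinal.{u}) : Prop := ∃ h ∈ g.val σ, EqAt f h σ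

theorem isKripke_iff (f : PreKSet.{u}) :
    IsKripke f ↔ (∀ σ, ∀ h ∈ f.val σ, IsKripke h) ∧ (∀ σ τ, σ < τ → f.val σ ⊆ f.val τ) ∧
      (∃ κ, ∀ τ, κ < τ → f.val τ = f.val κ) := by
  cases f with
  | mk I elt => simp [IsKripke, val]

theorem EqAt.symm {f g : PreKSet.{u}} {σ : Ordinal.{u}} (h : EqAt f g σ) : EqAt g f σ := by
  induction f generalizing g σ with
  | mk I f ih =>
    cases g with
    | mk J g =>
      intro τ hτ
      refine ⟨fun j => ?_, fun i => ?_⟩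
      · obtain ⟨i, hi⟩ := (h τ hτ).2 j
        exact ⟨i, ih τ i hi⟩
      · obtain ⟨j, hj⟩ := (h τ hτ).1 i
        exact ⟨j, ih τ i hj⟩

theorem eqAt_iff (f g : PreKSet.{u}) (σ : Ordinal.{u}) :
    EqAt f g σ ↔ ∀ τ, σ ≤ τ →
      (∀ h ∈ f.val τ, MemAt h g τ) ∧ (∀ h ∈ g.val τ, MemAt h f τ) := by
  cases f with
  | mk I f =>
    cases g with
    | mk J g =>
      simp only [EqAt, MemAt, val, Set.forall_mem_range, Set.exists_range_iff]
      refine forall₂_congr fun τ _ => and_congr_right fun _ => forall_congr' fun j => ?_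
      exact exists_congr fun i => ⟨EqAt.symm, EqAt.symm⟩

theorem EqAt.mono {f g : PreKSet.{u}} {σ τ : Ordinal.{u}} (hστ : σ ≤ τ) (h : EqAt f g σ) :
    EqAt f g τ := by
  rw [eqAt_iff] at h ⊢
  exact fun ρ hρ => h ρ (hστ.trans hρ)

theorem MemAt.mono {f g : PreKSet.{u}} (hg : IsKripke g) {σ τ : Ordinal.{u}} (hστ : σ ≤ τ)
    (h : MemAt f g σ) : MemAt f g τ := by
  obtain ⟨k, hk, hfk⟩ := h
  rcases hστ.eq_or_lt with rfl | hlt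
  · exact ⟨k, hk, hfk⟩
  · exact ⟨k, ((isKripke_iff g).1 hg).2.1 σ τ hlt hk, hfk.mono hστ⟩

end PreKSet

/-- The Kripke sets.  They form the universe of the model at every node, and the transition functions
between nodes are identities. -/
def KSet : Type (u + 1) := {f : PreKSet.{u} // f.IsKripke}

/-! ## The model -/

/-- `Forces φ κ v` is `κ ⊨ φ[v]`, by the usual clauses for Kripke models. -/
def Forces : {n : ℕ} → Fml n → Ordinal.{u} → (Fin n → KSet.{u}) → Prop
  | _, .bot, _, _ => False
  | _, .mem i j, κ, v => PreKSet.MemAt (v i).1 (v j).1 κ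
  | _, .eq i j, κ, v => PreKSet.EqAt (v i).1 (v j).1 κ
  | _, .and φ ψ, κ, v => Forces φ κ v ∧ Forces ψ κ v
  | _, .or φ ψ, κ, v => Forces φ κ v ∨ Forces ψ κ v
  | _, .imp φ ψ, κ, v => ∀ μ : Ordinal.{u}, κ ≤ μ → Forces φ μ v → Forces ψ μ v
  | n, .all φ, κ, v => ∀ μ : Ordinal.{u}, κ ≤ μ → ∀ x : KSet.{u},
      Forces φ μ (Fin.cons (α := fun _ : Fin (n + 1) => KSet.{u}) x v)
  | n, .ex φ, κ, v => ∃ x : KSet.{u},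
      Forces φ κ (Fin.cons (α := fun _ : Fin (n + 1) => KSet.{u}) x v)

theorem Forces.mono {n : ℕ} {φ : Fml n} {κ μ : Ordinal.{u}} (hκμ : κ ≤ μ) {v : Fin n → KSet.{u}}
    (h : Forces φ κ v) : Forces φ μ v := by
  induction φ generalizing κ μ with
  | bot => exact h
  | mem i j => exact PreKSet.MemAt.mono (v j).2 hκμ h
  | eq i j => exact PreKSet.EqAt.mono hκμ h
  | and φ ψ ih₁ ih₂ => exact ⟨ih₁ hκμ h.1, ih₂ hκμ h.2⟩
  | or φ ψ ih₁ ih₂ => exact h.imp (ih₁ hκμ) (ih₂ hκμ)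
  | imp φ ψ _ _ => exact fun ν hν => h ν (hκμ.trans hν)
  | all φ _ => exact fun ν hν => h ν (hκμ.trans hν)
  | ex φ ih =>
    obtain ⟨x, hx⟩ := h
    exact ⟨x, ih hκμ hx⟩

/-- A sentence holds in the model if every node forces it. -/
def Holds (σ : Fml 0) : Prop := ∀ κ : Ordinal.{u}, Forces σ κ Fin.elim0

end KripkeCZF

namespace KripkeCZF

open Fml

/-! ### Equality and membership at a node -/

namespace PreKSet

/-! The engine is `exists_kset`: every monotone family of subsets of one small set of Kripke sets is
a Kripke set. Eventual constancy is automatic, because each element has a first node of entry and a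
small set of ordinals is bounded (`exists_stage`). So a set-existence axiom is verified by naming
the desired elements at each node; persistence of forcing makes the family monotone, which gives
full Separation. For Strong Collection, a witness chosen at the first node where an element appears
serves at all later nodes (`exists_choice`). For Subset Collection, the image of `a` under such a
choice is determined by the nodes up to the one where `a` stabilizes, so there is only a small set
of candidates (`exists_images`).

Reflection fails by the same smallness. Beyond any node, a fresh element can still enter a set, so
no node decides all equalities. But a single Kripke set involves only a small set of pairs, whose
equalities are all settled by one node (`exists_decEq`); hence no node forces the relativized
sentence. -/

theorem EqAt.refl (f : PreKSet.{u}) (σ : Ordinal.{u}) : EqAt f f σ := by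
  induction f generalizing σ with
  | mk I f ih => exact fun τ _ => ⟨fun i => ⟨i, ih τ i τ⟩, fun i => ⟨i, ih τ i τ⟩⟩

theorem EqAt.trans {f g h : PreKSet.{u}} {σ : Ordinal.{u}} (h₁ : EqAt f g σ) (h₂ : EqAt g h σ) :
    EqAt f h σ := by
  induction f generalizing g h σ with
  | mk I f ih =>
    cases g with
    | mk J g =>
      cases h with
      | mk K h =>
        refine fun τ hτ => ⟨fun i => ?_, fun k => ?_⟩
        · obtain ⟨j, hj⟩ := (h₁ τ hτ).1 i
          obtain ⟨k, hk⟩ := (h₂ τ hτ).1 j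
          exact ⟨k, ih τ i hj hk⟩
        · obtain ⟨j, hj⟩ := (h₂ τ hτ).2 k
          obtain ⟨i, hi⟩ := (h₁ τ hτ).2 j
          exact ⟨i, ih τ i hi hj⟩

theorem MemAt.congr {f f' g g' : PreKSet.{u}} {σ : Ordinal.{u}} (hf : EqAt f f' σ)
    (hg : EqAt g g' σ) (h : MemAt f g σ) : MemAt f' g' σ := by
  obtain ⟨k, hk, hfk⟩ := h
  obtain ⟨l, hl, hkl⟩ := (((eqAt_iff g g' σ).1 hg) σ le_rfl).1 k hk
  exact ⟨l, hl, (hf.symm.trans hfk).trans hkl⟩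

end PreKSet

open PreKSet

/-! ### Kripke sets as monotone families -/

namespace KSet

/-- The set of Kripke sets that `f` assigns to the node `σ`. -/
def el (f : KSet.{u}) (σ : Ordinal.{u}) : Set KSet.{u} := {h | h.1 ∈ f.1.val σ}

theorem memAt_iff {f g : KSet.{u}} {σ : Ordinal.{u}} :
    MemAt f.1 g.1 σ ↔ ∃ h ∈ g.el σ, EqAt f.1 h.1 σ :=
  ⟨fun ⟨h, hh, e⟩ => ⟨⟨h, ((isKripke_iff g.1).1 g.2).1 σ h hh⟩, hh, e⟩,
    fun ⟨h, hh, e⟩ => ⟨h.1, hh, e⟩⟩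

theorem memAt_of_mem {f g : KSet.{u}} {σ : Ordinal.{u}} (h : f ∈ g.el σ) : MemAt f.1 g.1 σ :=
  ⟨f.1, h, EqAt.refl _ _⟩

theorem eqAt_iff {f g : KSet.{u}} {σ : Ordinal.{u}} :
    EqAt f.1 g.1 σ ↔ ∀ τ, σ ≤ τ →
      (∀ h ∈ f.el τ, MemAt h.1 g.1 τ) ∧ (∀ h ∈ g.el τ, MemAt h.1 f.1 τ) := by
  rw [PreKSet.eqAt_iff]
  refine forall₂_congr fun τ _ => and_congr ⟨fun H h hh => H _ hh, fun H h hh => ?_⟩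
    ⟨fun H h hh => H _ hh, fun H h hh => ?_⟩
  · exact H ⟨h, ((isKripke_iff f.1).1 f.2).1 τ h hh⟩ hh
  · exact H ⟨h, ((isKripke_iff g.1).1 g.2).1 τ h hh⟩ hh

theorem el_mono (f : KSet.{u}) : Monotone f.el := by
  intro σ τ hστ h hh
  rcases hστ.eq_or_lt with rfl | hlt
  · exact hh
  · exact ((isKripke_iff f.1).1 f.2).2.1 σ τ hlt hh

theorem exists_el_eq (f : KSet.{u}) : ∃ κ, ∀ τ, κ ≤ τ → f.el τ = f.el κ := by
  obtain ⟨κ, hκ⟩ := ((isKripke_iff f.1).1 f.2).2.2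
  refine ⟨κ, fun τ hτ => ?_⟩
  rcases hτ.eq_or_lt with rfl | hlt
  · rfl
  · simp only [el, hκ τ hlt]

theorem small_val (f : PreKSet.{u}) (σ : Ordinal.{u}) : Small.{u} (f.val σ) := by
  cases f with
  | mk I elt => exact small_range (elt σ)

instance small_el (f : KSet.{u}) (σ : Ordinal.{u}) : Small.{u} (f.el σ) := by
  have := small_val f.1 σ
  exact small_of_injective (f := fun h : f.el σ => (⟨h.1.1, h.2⟩ : f.1.val σ)) fun x y h =>
    Subtype.ext (Subtype.ext (Subtype.mk.inj h))

/-- The eventual value contains all earlier ones by monotonicity. It supplies the small set required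
by `exists_kset`. -/
theorem exists_small_bound (f : KSet.{u}) :
    ∃ S : Set KSet.{u}, Small.{u} S ∧ ∀ σ, f.el σ ⊆ S := by
  obtain ⟨κ, hκ⟩ := f.exists_el_eq
  refine ⟨f.el κ, inferInstance, fun σ => ?_⟩
  rw [← hκ (max σ κ) (le_max_right _ _)]
  exact f.el_mono (le_max_left _ _)

end KSet

/-- A small family of properties of ordinals is decided below a single ordinal. -/
theorem exists_stage {ι : Type*} [Small.{u} ι] (P : ι → Ordinal.{u} → Prop) :
    ∃ κ, ∀ i σ, P i σ → ∃ τ ≤ κ, P i τ := by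
  -- The least ordinal satisfying `P i` is used for each `i`; if there is none, the infimum is the
  -- default 0, which does no harm.
  have hb : BddAbove (Set.range fun i => sInf {σ | P i σ}) := Ordinal.bddAbove_of_small
  obtain ⟨κ, hκ⟩ := hb
  exact ⟨κ, fun i σ h => ⟨_, hκ ⟨i, rfl⟩, csInf_mem (s := {σ | P i σ}) ⟨σ, h⟩⟩⟩

/-- Every monotone family of subsets of a small set is given by a Kripke set. -/
theorem exists_kset (S : Set KSet.{u}) [Small.{u} S] (B : Ordinal.{u} → Set KSet.{u})
    (hB : Monotone B) (hS : ∀ σ, B σ ⊆ S) : ∃ f : KSet.{u}, ∀ σ, f.el σ = B σ := by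
  have hs : ∀ σ, Small.{u} (B σ) := fun σ => small_subset (hS σ)
  let f : PreKSet.{u} := .mk (fun σ => Shrink.{u} (B σ)) fun σ i => ((equivShrink (B σ)).symm i).1.1
  have hval : ∀ σ, f.val σ = Subtype.val '' B σ := by
    intro σ
    ext h
    constructor
    · rintro ⟨i, rfl⟩
      exact ⟨_, ((equivShrink (B σ)).symm i).2, rfl⟩
    · rintro ⟨k, hk, rfl⟩
      exact ⟨equivShrink (B σ) ⟨k, hk⟩, by simp⟩
  have hf : f.IsKripke := by
    rw [isKripke_iff]
    simp only [hval]
    refine ⟨?_, fun σ τ h => Set.image_mono (hB h.le), ?_⟩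
    · rintro σ _ ⟨k, -, rfl⟩
      exact k.2
    · obtain ⟨κ, hκ⟩ := exists_stage (fun (i : S) σ => i.1 ∈ B σ)
      refine ⟨κ, fun τ hτ => congrArg _ (Set.Subset.antisymm (fun x hx => ?_) (hB hτ.le))⟩
      obtain ⟨ρ, hρ, h⟩ := hκ ⟨x, hS τ hx⟩ τ hx
      exact hB hρ h
  refine ⟨⟨f, hf⟩, fun σ => ?_⟩
  ext h
  change h.1 ∈ f.val σ ↔ _
  rw [hval]
  exact Subtype.val_injective.mem_set_image

/-- Every small set of Kripke sets is the constant value of a Kripke set. -/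
theorem exists_const (S : Set KSet.{u}) [Small.{u} S] : ∃ f : KSet.{u}, ∀ σ, f.el σ = S :=
  exists_kset S (fun _ => S) monotone_const fun _ => subset_rfl

/-- Witnesses for the elements of `a` from the node `κ` on can be chosen independently of the
node. -/
theorem exists_choice (a : KSet.{u}) (κ : Ordinal.{u})
    (R : KSet.{u} → KSet.{u} → Ordinal.{u} → Prop)
    (hR : ∀ x y σ τ, σ ≤ τ → R x y σ → R x y τ)
    (h : ∀ μ, κ ≤ μ → ∀ x ∈ a.el μ, ∃ y, R x y μ) :
    ∃ Y : KSet.{u} → KSet.{u}, ∀ μ, κ ≤ μ → ∀ x ∈ a.el μ, R x (Y x) μ := by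
  have key : ∀ x, ∃ y, ∀ μ, κ ≤ μ → x ∈ a.el μ → R x y μ := by
    intro x
    by_cases hx : ∃ μ, κ ≤ μ ∧ x ∈ a.el μ
    -- The witness is taken at the first node from `κ` on where `x` is present; persistence of `R`
    -- carries it upwards.
    · obtain ⟨h₁, h₂⟩ := csInf_mem (s := {μ | κ ≤ μ ∧ x ∈ a.el μ}) hx
      obtain ⟨y, hy⟩ := h _ h₁ x h₂
      exact ⟨y, fun μ hμ hxμ => hR _ _ _ _ (csInf_le' (Set.mem_ofPred.2 ⟨hμ, hxμ⟩)) hy⟩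
    · exact ⟨x, fun μ hμ hxμ => (hx ⟨μ, hμ, hxμ⟩).elim⟩
  choose Y hY using key
  exact ⟨Y, fun μ hμ x hx => hY x μ hμ hx⟩

/-! ## Forcing -/

/-- Extension of a valuation by a value for the variable `0`. -/
abbrev KSet.push {n : ℕ} (x : KSet.{u}) (v : Fin n → KSet.{u}) : Fin (n + 1) → KSet.{u} :=
  Fin.cons (α := fun _ : Fin (n + 1) => KSet.{u}) x v

section Forcing

variable {n m : ℕ} {κ : Ordinal.{u}} {v : Fin n → KSet.{u}}

theorem forces_iff {φ ψ : Fml n} :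
    Forces (.iff φ ψ) κ v ↔ ∀ μ, κ ≤ μ → (Forces φ μ v ↔ Forces ψ μ v) :=
  ⟨fun h μ hμ => ⟨h.1 μ hμ, h.2 μ hμ⟩, fun h => ⟨fun μ hμ => (h μ hμ).1, fun μ hμ => (h μ hμ).2⟩⟩

theorem forces_rename {φ : Fml n} {r : Fin n → Fin m} {w : Fin m → KSet.{u}} :
    Forces (φ.rename r) κ w ↔ Forces φ κ (fun i => w (r i)) := by
  induction φ generalizing m κ with
  | bot => exact Iff.rfl
  | mem i j => exact Iff.rfl
  | eq i j => exact Iff.rfl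
  | and φ ψ ih₁ ih₂ => exact and_congr ih₁ ih₂
  | or φ ψ ih₁ ih₂ => exact or_congr ih₁ ih₂
  | imp φ ψ ih₁ ih₂ => exact forall₂_congr fun μ _ => imp_congr ih₁ ih₂
  | all φ ih =>
    refine forall₃_congr fun μ _ x => ih.trans (iff_of_eq (congrArg _ (funext fun i => ?_)))
    cases i using Fin.cases <;> rfl
  | ex φ ih =>
    refine exists_congr fun x => ih.trans (iff_of_eq (congrArg _ (funext fun i => ?_)))
    cases i using Fin.cases <;> rfl

/-- Forcing respects equality at the node because equality persists. This lets bounded quantifiers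
range over actual elements of `el`, instead of everything forced equal to one. -/
theorem Forces.congr {φ : Fml n} {w : Fin n → KSet.{u}} (hvw : ∀ i, EqAt (v i).1 (w i).1 κ)
    (h : Forces φ κ v) : Forces φ κ w := by
  have push : ∀ {k : ℕ} {v w : Fin k → KSet.{u}} {μ : Ordinal.{u}} (x : KSet.{u}),
      (∀ i, EqAt (v i).1 (w i).1 μ) → ∀ i, EqAt (x.push v i).1 (x.push w i).1 μ := by
    intro k v w μ x h i
    cases i using Fin.cases with
    | zero => exact EqAt.refl _ _
    | succ i => exact h i
  induction φ generalizing κ with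
  | bot => exact h
  | mem i j => exact MemAt.congr (hvw i) (hvw j) h
  | eq i j => exact ((hvw i).symm.trans h).trans (hvw j)
  | and φ ψ ih₁ ih₂ => exact ⟨ih₁ hvw h.1, ih₂ hvw h.2⟩
  | or φ ψ ih₁ ih₂ => exact h.imp (ih₁ hvw) (ih₂ hvw)
  | imp φ ψ ih₁ ih₂ =>
    exact fun μ hμ hφ => ih₂ (fun i => (hvw i).mono hμ)
      (h μ hμ (ih₁ (fun i => ((hvw i).mono hμ).symm) hφ))
  | all φ ih => exact fun μ hμ x => ih (push x fun i => (hvw i).mono hμ) (h μ hμ x)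
  | ex φ ih =>
    obtain ⟨x, hx⟩ := h
    exact ⟨x, ih (push x hvw) hx⟩

theorem Forces.congr_head {φ : Fml (n + 1)} {x y : KSet.{u}} (hxy : EqAt x.1 y.1 κ)
    (h : Forces φ κ (x.push v)) : Forces φ κ (y.push v) := by
  refine h.congr fun i => ?_
  cases i using Fin.cases with
  | zero => exact hxy
  | succ i => exact EqAt.refl _ _

theorem forces_ball {t : Fin n} {φ : Fml (n + 1)} :
    Forces (ball t φ) κ v ↔ ∀ μ, κ ≤ μ → ∀ x ∈ (v t).el μ, Forces φ μ (x.push v) := by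
  constructor
  · exact fun h μ hμ x hx => h μ hμ x μ le_rfl (KSet.memAt_of_mem hx)
  · intro h μ hμ x ν hν hx
    obtain ⟨y, hy, hxy⟩ := KSet.memAt_iff.1 hx
    exact (h ν (hμ.trans hν) y hy).congr_head hxy.symm

theorem forces_bex {t : Fin n} {φ : Fml (n + 1)} :
    Forces (bex t φ) κ v ↔ ∃ x ∈ (v t).el κ, Forces φ κ (x.push v) := by
  constructor
  · rintro ⟨x, hx, h⟩
    obtain ⟨y, hy, hxy⟩ := KSet.memAt_iff.1 hx
    exact ⟨y, hy, h.congr_head hxy⟩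
  · rintro ⟨x, hx, h⟩
    exact ⟨x, KSet.memAt_of_mem hx, h⟩

theorem holds_close : {n : ℕ} → {φ : Fml n} →
    (∀ (κ : Ordinal.{u}) (v : Fin n → KSet.{u}), Forces φ κ v) → Holds.{u} φ.close
  | 0, _, h => fun κ => h κ _
  | _ + 1, φ, h => holds_close (φ := .all φ) fun _ v μ _ x => h μ (x.push v)

end Forcing

/-! ## The axioms of equality -/

theorem holds_equalityAxiom {σ : Fml 0} (h : EqualityAxiom σ) : Holds.{u} σ := by
  intro κ
  cases h with
  | eqRefl => exact fun μ _ x => EqAt.refl _ _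
  | eqSymm => exact fun _ _ x _ _ y ν _ h => EqAt.symm h
  | eqTrans => exact fun _ _ x _ _ y _ _ z ν _ h => EqAt.trans h.1 h.2
  | eqMemLeft => exact fun _ _ x _ _ y _ _ z ν _ h => MemAt.congr h.1 (EqAt.refl _ _) h.2
  | eqMemRight => exact fun _ _ x _ _ y _ _ z ν _ h => MemAt.congr (EqAt.refl _ _) h.1 h.2

/-! ## The axioms of CZF -/

theorem holds_extensionality : Holds.{u} extensionality := by
  intro κ μ _ x ν _ y
  refine forces_iff.2 fun ρ _ => ⟨fun h σ hσ z => forces_iff.2 fun τ hτ => ?_, fun h => ?_⟩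
  · have h' := EqAt.mono (hσ.trans hτ) h
    exact ⟨MemAt.congr (EqAt.refl _ _) h', MemAt.congr (EqAt.refl _ _) h'.symm⟩
  · refine KSet.eqAt_iff.2 fun τ hτ => ⟨fun z hz => ?_, fun z hz => ?_⟩
    · exact (forces_iff.1 (h τ hτ z) τ le_rfl).1 (KSet.memAt_of_mem hz)
    · exact (forces_iff.1 (h τ hτ z) τ le_rfl).2 (KSet.memAt_of_mem hz)

theorem holds_emptySet : Holds.{u} emptySet := by
  intro κ
  obtain ⟨e, he⟩ := exists_const.{u} ∅
  refine ⟨e, fun μ _ y ν _ h => ?_⟩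
  obtain ⟨z, hz, -⟩ := KSet.memAt_iff.1 h
  exact (Set.ext_iff.1 (he ν) z).1 hz

theorem holds_pairing : Holds.{u} pairing := by
  intro κ μ _ x ν _ y
  obtain ⟨p, hp⟩ := exists_const {x, y}
  refine ⟨p, fun ρ _ w => forces_iff.2 fun τ _ => KSet.memAt_iff.trans ?_⟩
  change (∃ h ∈ p.el τ, EqAt w.1 h.1 τ) ↔ EqAt w.1 x.1 τ ∨ EqAt w.1 y.1 τ
  rw [hp]
  simp

theorem holds_union : Holds.{u} Fml.union := by
  intro κ μ _ x
  obtain ⟨S, hS, hxS⟩ := x.exists_small_bound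
  choose T hT hyT using KSet.exists_small_bound.{u}
  obtain ⟨z, hz⟩ := exists_kset (⋃ y : S, T y.1) (fun σ => ⋃ y ∈ x.el σ, y.el σ)
    (fun σ τ h => Set.biUnion_mono (x.el_mono h) fun y _ => y.el_mono h)
    (fun σ => Set.iUnion₂_subset fun y hy =>
      (hyT y σ).trans (Set.subset_iUnion (fun y : S => T y.1) ⟨y, hxS σ hy⟩))
  refine ⟨z, fun ρ _ w => forces_iff.2 fun τ _ =>
    KSet.memAt_iff.trans (Iff.trans ?_ forces_bex.symm)⟩
  change (∃ h ∈ z.el τ, EqAt w.1 h.1 τ) ↔ ∃ y ∈ x.el τ, MemAt w.1 y.1 τ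
  simp only [hz, KSet.memAt_iff, Set.mem_iUnion₂]
  exact ⟨fun ⟨h, ⟨y, hy, hh⟩, e⟩ => ⟨y, hy, h, hh, e⟩, fun ⟨y, hy, h, hh, e⟩ => ⟨h, ⟨y, hy, hh⟩, e⟩⟩

theorem exists_succ (k : KSet.{u}) : ∃ m : KSet.{u}, ∀ σ, m.el σ = insert k (k.el σ) := by
  obtain ⟨S, hS, hkS⟩ := k.exists_small_bound
  exact exists_kset (insert k S) (fun σ => insert k (k.el σ))
    (fun σ τ h => Set.insert_subset_insert (k.el_mono h))
    (fun σ => Set.insert_subset_insert (hkS σ))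

theorem memAt_succ {k m : KSet.{u}} (hm : ∀ σ, m.el σ = insert k (k.el σ)) (w : KSet.{u})
    (σ : Ordinal.{u}) : MemAt w.1 m.1 σ ↔ MemAt w.1 k.1 σ ∨ EqAt w.1 k.1 σ := by
  simp [KSet.memAt_iff, hm, or_comm]

theorem forces_isInductive {n : ℕ} {t : Fin n} {κ : Ordinal.{u}} {v : Fin n → KSet.{u}} :
    Forces (isInductive t) κ v ↔
      (∃ e ∈ (v t).el κ, ∀ μ, κ ≤ μ → ∀ y : KSet.{u}, ¬ MemAt y.1 e.1 μ) ∧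
      ∀ μ, κ ≤ μ → ∀ k ∈ (v t).el μ, ∃ m ∈ (v t).el μ, ∀ ν, μ ≤ ν → ∀ y : KSet.{u},
        (MemAt y.1 m.1 ν ↔ MemAt y.1 k.1 ν ∨ EqAt y.1 k.1 ν) := by
  refine and_congr (forces_bex.trans (exists_congr fun e => and_congr_right fun _ => ?_))
    (forces_ball.trans (forall₄_congr fun μ _ k _ => forces_bex.trans
      (exists_congr fun m => and_congr_right fun _ => ?_)))
  · exact ⟨fun h μ hμ y => h μ hμ y μ le_rfl, fun h μ hμ y ν hν => h ν (hμ.trans hν) y⟩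
  · exact ⟨fun h ν hν y => forces_iff.1 (h ν hν y) ν le_rfl,
      fun h ν hν y => forces_iff.2 fun ρ hρ => h ρ (hν.trans hρ) y⟩

theorem holds_strongInfinity : Holds.{u} strongInfinity := by
  intro κ
  obtain ⟨e, he⟩ := exists_const.{u} ∅
  choose s hs using exists_succ.{u}
  have he' : ∀ (y : KSet.{u}) μ, ¬ MemAt y.1 e.1 μ := by simp [KSet.memAt_iff, he]
  -- The von Neumann numerals, the same at every node.
  obtain ⟨w, hw⟩ := exists_const (Set.range fun i : ℕ => s^[i] e)
  refine ⟨w, forces_isInductive.2 ⟨⟨e, ?_, fun μ _ y => he' y μ⟩, fun μ _ k hk => ?_⟩, ?_⟩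
  · exact (hw κ).symm ▸ ⟨0, rfl⟩
  · obtain ⟨i, rfl⟩ := hw μ ▸ hk
    refine ⟨s (s^[i] e), (hw μ).symm ▸ ⟨i + 1, Function.iterate_succ_apply' s i e⟩, ?_⟩
    exact fun ν _ y => memAt_succ (hs _) y ν
  · intro μ _ b ν _ hb
    obtain ⟨⟨e₁, he₁, hempty⟩, hsucc⟩ := forces_isInductive.1 hb
    refine forces_ball.2 fun ρ hρ x hx => ?_
    obtain ⟨i, rfl⟩ := hw ρ ▸ hx
    change MemAt (s^[i] e).1 b.1 ρ
    clear hx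
    induction i with
    | zero =>
      refine KSet.memAt_iff.2 ⟨e₁, b.el_mono hρ he₁, KSet.eqAt_iff.2 fun τ hτ => ⟨?_, ?_⟩⟩
      · exact fun h hh => (he' h τ (KSet.memAt_of_mem hh)).elim
      · exact fun h hh => (hempty τ (hρ.trans hτ) h (KSet.memAt_of_mem hh)).elim
    | succ i ih =>
      -- The successor supplied by `b` is only specified by its members, so it is matched with the
      -- next numeral by comparing members at all later nodes.
      obtain ⟨k, hk, hik⟩ := KSet.memAt_iff.1 ih
      obtain ⟨m, hm, hmk⟩ := hsucc ρ hρ k hk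
      refine KSet.memAt_iff.2 ⟨m, hm, ?_⟩
      rw [Function.iterate_succ_apply']
      refine KSet.eqAt_iff.2 fun τ hτ => ⟨fun h hh => ?_, fun h hh => ?_⟩
      · refine (hmk τ hτ h).2 (((memAt_succ (hs _) h τ).1 (KSet.memAt_of_mem hh)).imp ?_ ?_)
        · exact MemAt.congr (EqAt.refl _ _) (hik.mono hτ)
        · exact fun h' => h'.trans (hik.mono hτ)
      · refine (memAt_succ (hs _) h τ).2 (((hmk τ hτ h).1 (KSet.memAt_of_mem hh)).imp ?_ ?_)
        · exact MemAt.congr (EqAt.refl _ _) (hik.mono hτ).symm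
        · exact fun h' => h'.trans (hik.mono hτ).symm

theorem KSet.induction {P : KSet.{u} → Prop} (h : ∀ x, (∀ σ, ∀ y ∈ x.el σ, P y) → P x)
    (x : KSet.{u}) : P x := by
  obtain ⟨f, hf⟩ := x
  induction f with
  | mk I elt ih =>
    refine h _ fun σ y hy => ?_
    obtain ⟨i, hi⟩ := hy
    obtain ⟨y, hy⟩ := y
    subst hi
    exact ih σ i hy

theorem holds_setInduction {n : ℕ} (φ : Fml (n + 1)) : Holds.{u} (setInduction φ) := by
  refine holds_close fun κ v μ _ h ν hν x => ?_
  -- The node must vary in the induction, since elements of `x` are needed at later nodes.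
  induction x using KSet.induction generalizing ν with
  | h x ih =>
    refine h ν hν x ν le_rfl (forces_ball.2 fun ρ hρ y hy => forces_rename.2 ?_)
    convert ih ρ y hy ρ (hν.trans hρ) using 2 with i
    cases i using Fin.cases <;> rfl

theorem holds_separation {n : ℕ} (φ : Fml (n + 1)) : Holds.{u} (separation φ) := by
  refine holds_close fun κ v μ _ a => ?_
  obtain ⟨S, hS, haS⟩ := a.exists_small_bound
  obtain ⟨b, hb⟩ := exists_kset S (fun σ => {x ∈ a.el σ | Forces φ σ (x.push v)})
    (fun σ τ h x hx => ⟨a.el_mono h hx.1, hx.2.mono h⟩) (fun σ x hx => haS σ hx.1)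
  refine ⟨b, fun ρ _ x => forces_iff.2 fun τ _ => ?_⟩
  have hφ : Forces (φ.rename (Fin.cons 0 (fun i => i.addNat 3))) τ (x.push (b.push (a.push v))) ↔
      Forces φ τ (x.push v) := by
    refine forces_rename.trans (iff_of_eq (congrArg _ (funext fun i => ?_)))
    cases i using Fin.cases <;> rfl
  refine Iff.trans ?_ (and_congr_right' hφ.symm)
  change MemAt x.1 b.1 τ ↔ MemAt x.1 a.1 τ ∧ _
  simp only [KSet.memAt_iff, hb]
  constructor
  · rintro ⟨h, ⟨hh, hf⟩, e⟩
    exact ⟨⟨h, hh, e⟩, hf.congr_head e.symm⟩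
  · rintro ⟨⟨h, hh, e⟩, hf⟩
    exact ⟨h, ⟨hh, hf.congr_head e⟩, e⟩

theorem holds_strongCollection {n : ℕ} (φ : Fml (n + 2)) : Holds.{u} (strongCollection φ) := by
  refine holds_close fun _ v _ _ a κ _ h => ?_
  obtain ⟨Y, hY⟩ := exists_choice a κ (fun x y σ => Forces φ σ (y.push (x.push v)))
    (fun x y σ τ hστ => Forces.mono hστ) (by
      intro μ hμ x hx
      obtain ⟨y, hy⟩ := forces_ball.1 h μ hμ x hx
      refine ⟨y, ?_⟩
      convert forces_rename.1 hy using 2 with i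
      cases i using Fin.cases with
      | zero => rfl
      | succ i => cases i using Fin.cases <;> rfl)
  obtain ⟨S, hS, haS⟩ := a.exists_small_bound
  obtain ⟨b, hb⟩ := exists_kset (Y '' S) (fun σ => Y '' a.el σ)
    (fun σ τ h => Set.image_mono (a.el_mono h)) (fun σ => Set.image_mono (haS σ))
  refine ⟨b, forces_ball.2 fun μ hμ x hx => forces_bex.2 ⟨Y x, ?_, forces_rename.2 ?_⟩,
    forces_ball.2 fun μ hμ y hy => ?_⟩
  · exact (hb μ).symm ▸ Set.mem_image_of_mem Y hx
  · convert hY μ hμ x hx using 2 with i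
    cases i using Fin.cases with
    | zero => rfl
    | succ i => cases i using Fin.cases <;> rfl
  · obtain ⟨x, hx, rfl⟩ := hb μ ▸ hy
    refine forces_bex.2 ⟨x, hx, forces_rename.2 ?_⟩
    convert hY μ hμ x hx using 2 with i
    cases i using Fin.cases with
    | zero => rfl
    | succ i => cases i using Fin.cases <;> rfl

/-- A Kripke set containing, at every node, all Kripke sets that from some node on are the image of
`a` under a function with values in `b`. -/
theorem exists_images (a b : KSet.{u}) : ∃ c : KSet.{u}, ∀ κ, ∀ Y : KSet.{u} → KSet.{u},
    (∀ μ, κ ≤ μ → ∀ x ∈ a.el μ, Y x ∈ b.el μ) →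
    ∃ d ∈ c.el κ, ∀ μ, κ ≤ μ → d.el μ = Y '' a.el μ := by
  obtain ⟨S, hS, hbS⟩ := b.exists_small_bound
  obtain ⟨θ, hθ⟩ := a.exists_el_eq
  -- A candidate is coded by a family of subsets of `S` indexed by the nodes up to `θ`, so the codes
  -- form a small type. Taking the union over earlier indices makes the coded family monotone for
  -- arbitrary `F`.
  have hD : ∀ F : Set.Iic θ → Set S, ∃ d : KSet.{u}, ∀ σ,
      d.el σ = {y | ∃ ν : Set.Iic θ, ν.1 ≤ σ ∧ ∃ hy : y ∈ S, ⟨y, hy⟩ ∈ F ν} := fun F =>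
    exists_kset S _ (fun σ τ h y ⟨ν, hν, hy⟩ => ⟨ν, hν.trans h, hy⟩) (fun σ y ⟨_, _, hy, _⟩ => hy)
  choose D hD using hD
  obtain ⟨c, hc⟩ := exists_const (Set.range D)
  refine ⟨c, fun κ Y hY => ?_⟩
  -- The maximum with `κ` is needed because `Y` is known to take values in `b` only from `κ` on.
  refine ⟨D fun ν => {y | y.1 ∈ Y '' a.el (max ν.1 κ)}, (hc κ).symm ▸ ⟨_, rfl⟩, fun μ hμ => ?_⟩
  rw [hD]
  ext y
  constructor
  · rintro ⟨ν, hν, -, x, hx, rfl⟩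
    exact ⟨x, a.el_mono (max_le hν hμ) hx, rfl⟩
  · rintro ⟨x, hx, rfl⟩
    -- Past `θ` the set `a` no longer changes, so the index `θ` stands for all later nodes.
    refine ⟨⟨min μ θ, Set.mem_Iic.2 (min_le_right _ _)⟩, min_le_left _ _,
      hbS μ (hY μ hμ x hx), x, ?_, rfl⟩
    change x ∈ a.el (max (min μ θ) κ)
    rcases le_total μ θ with h | h
    · simpa [min_eq_left h, max_eq_left hμ] using hx
    · rw [min_eq_right h, hθ _ (le_max_left _ _), ← hθ μ h]
      exact hx

theorem holds_subsetCollection {n : ℕ} (φ : Fml (n + 3)) : Holds.{u} (subsetCollection φ) := by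
  refine holds_close fun _ v _ _ a _ _ b => ?_
  obtain ⟨c, hc⟩ := exists_images a b
  refine ⟨c, fun _ _ w κ _ h => ?_⟩
  -- Membership in `b` is built into the relation, so that `Y` has values in `b` and its image is
  -- among the candidates in `c`.
  obtain ⟨Y, hY⟩ := exists_choice a κ
    (fun x y σ => y ∈ b.el σ ∧ Forces φ σ (y.push (x.push (w.push v))))
    (fun x y σ τ hστ h => ⟨b.el_mono hστ h.1, h.2.mono hστ⟩) (by
      intro μ hμ x hx
      obtain ⟨y, hyb, hy⟩ := forces_bex.1 (forces_ball.1 h μ hμ x hx)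
      refine ⟨y, hyb, ?_⟩
      convert forces_rename.1 hy using 2 with i
      cases i using Fin.cases with
      | zero => rfl
      | succ i =>
        cases i using Fin.cases with
        | zero => rfl
        | succ i => cases i using Fin.cases <;> rfl)
  obtain ⟨d, hd, hda⟩ := hc κ Y fun μ hμ x hx => (hY μ hμ x hx).1
  refine forces_bex.2 ⟨d, hd, forces_ball.2 fun μ hμ x hx =>
    forces_bex.2 ⟨Y x, ?_, forces_rename.2 ?_⟩, forces_ball.2 fun μ hμ y hy => ?_⟩
  · exact (hda μ hμ).symm ▸ Set.mem_image_of_mem Y hx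
  · convert (hY μ hμ x hx).2 using 2 with i
    cases i using Fin.cases with
    | zero => rfl
    | succ i =>
      cases i using Fin.cases with
      | zero => rfl
      | succ i => cases i using Fin.cases <;> rfl
  · obtain ⟨x, hx, rfl⟩ := hda μ hμ ▸ hy
    refine forces_bex.2 ⟨x, hx, forces_rename.2 ?_⟩
    convert (hY μ hμ x hx).2 using 2 with i
    cases i using Fin.cases with
    | zero => rfl
    | succ i =>
      cases i using Fin.cases with
      | zero => rfl
      | succ i => cases i using Fin.cases <;> rfl

theorem holds_czf {σ : Fml 0} (h : CZF σ) : Holds.{u} σ := by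
  cases h with
  | extensionality => exact holds_extensionality
  | emptySet => exact holds_emptySet
  | pairing => exact holds_pairing
  | union => exact holds_union
  | strongInfinity => exact holds_strongInfinity
  | setInduction φ => exact holds_setInduction φ
  | restrictedSeparation φ _ => exact holds_separation φ
  | strongCollection φ => exact holds_strongCollection φ
  | subsetCollection φ => exact holds_subsetCollection φ

/-! ## Failure of Reflection -/

/-- No node forces equality to be decidable: equality of a constant singleton with a singleton whose
element appears later is undecided. -/
theorem holds_notDecEq : Holds.{u} notDecEq := by
  intro _ κ _ h
  obtain ⟨e, -⟩ := exists_const.{u} ∅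
  obtain ⟨x, hx⟩ := exists_const {e}
  -- The strict inequality keeps `y` empty at `κ`, while from the successor of `κ` on it agrees with
  -- `x`.
  obtain ⟨y, hy⟩ := exists_kset {e} (fun σ => {z | z = e ∧ κ < σ})
    (fun σ τ hστ z hz => ⟨hz.1, hz.2.trans_le hστ⟩) (fun σ z hz => hz.1)
  rcases h κ le_rfl x κ le_rfl y with heq | hne
  · obtain ⟨z, hz, -⟩ := KSet.memAt_iff.1
      ((KSet.eqAt_iff.1 heq κ le_rfl).1 e ((hx κ).symm ▸ rfl))
    change z ∈ y.el κ at hz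
    rw [hy] at hz
    exact lt_irrefl κ hz.2
  · refine hne (Order.succ κ) (Order.le_succ κ) (KSet.eqAt_iff.2 fun τ hτ => ?_)
    have hxy : x.el τ = y.el τ := by
      rw [hx, hy]
      ext z
      simp [Order.succ_le_iff.1 hτ]
    exact ⟨fun z hz => KSet.memAt_of_mem (hxy ▸ hz), fun z hz => KSet.memAt_of_mem (hxy ▸ hz)⟩

/-- Above any node there is one that decides all equalities between elements of `a`. -/
theorem exists_decEq (a : KSet.{u}) (κ : Ordinal.{u}) : ∃ μ, κ ≤ μ ∧ ∀ ν, μ ≤ ν → ∀ x ∈ a.el ν,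
    ∀ ρ, ν ≤ ρ → ∀ y ∈ a.el ρ, EqAt x.1 y.1 ρ ∨ ∀ τ, ρ ≤ τ → ¬ EqAt x.1 y.1 τ := by
  obtain ⟨S, hS, haS⟩ := a.exists_small_bound
  -- Any equality between elements of `S` that ever becomes true is already true at `θ`; failure
  -- from then on is permanent.
  obtain ⟨θ, hθ⟩ := exists_stage (fun (p : S × S) σ => EqAt p.1.1.1 p.2.1.1 σ)
  refine ⟨max κ θ, le_max_left _ _, fun ν hν x hx ρ hρ y hy => or_iff_not_imp_left.2 ?_⟩
  intro hne τ _ heq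
  obtain ⟨σ, hσ, h⟩ := hθ (⟨x, haS ν hx⟩, ⟨y, haS ρ hy⟩) τ heq
  exact hne (h.mono (hσ.trans ((le_max_right κ θ).trans (hν.trans hρ))))

/-- A forced negation excludes its body at all later nodes, but `exists_decEq` provides one where
equality on `v t` is decidable. -/
theorem not_forces_relTo_notDecEq {m : ℕ} {t : Fin m} {r : Fin 0 → Fin m} {κ : Ordinal.{u}}
    {v : Fin m → KSet.{u}} : ¬ Forces (relTo t (notDecEq.rename r)) κ v := by
  intro h
  obtain ⟨μ, hμ, hdec⟩ := exists_decEq (v t) κ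
  exact h μ hμ (forces_ball.2 fun ν hν x hx =>
    forces_ball.2 fun ρ hρ y hy => hdec ν hν x hx ρ hρ y hy)

theorem holds_all_neg_relTo_notDecEq :
    Holds.{u} (.all (.neg (relTo 0 (notDecEq.rename Fin.elim0)))) :=
  fun _ _ _ _ _ _ => not_forces_relTo_notDecEq

theorem holds_neg_reflection_notDecEq : Holds.{u} (.neg (reflection notDecEq)) := by
  intro _ κ _ h
  obtain ⟨e, -⟩ := exists_const.{u} ∅
  obtain ⟨a, -, -, ha⟩ := h κ le_rfl e
  refine not_forces_relTo_notDecEq (ha.1 κ le_rfl (forces_rename.2 ?_))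
  -- Reflection would transfer the sentence, forced at `κ`, to its relativization to `a`, which no
  -- node forces.
  convert holds_notDecEq.{u} κ

end KripkeCZF

theorem mainTheorem3 :
    (∀ σ : KripkeCZF.Fml 0, KripkeCZF.Fml.EqualityAxiom σ → KripkeCZF.Holds.{u} σ) ∧
    (∀ σ : KripkeCZF.Fml 0, KripkeCZF.Fml.CZF σ → KripkeCZF.Holds.{u} σ) ∧
    (∀ (n : ℕ) (φ : KripkeCZF.Fml (n + 1)),
      KripkeCZF.Holds.{u} (KripkeCZF.Fml.separation φ)) ∧
    KripkeCZF.Holds.{u} (.neg (KripkeCZF.Fml.reflection KripkeCZF.Fml.notDecEq)) ∧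
    KripkeCZF.Holds.{u} KripkeCZF.Fml.notDecEq ∧
    KripkeCZF.Holds.{u}
      (.all (.neg (KripkeCZF.Fml.relTo 0 (KripkeCZF.Fml.notDecEq.rename Fin.elim0)))) := by
  exact ⟨fun _ => KripkeCZF.holds_equalityAxiom, fun _ => KripkeCZF.holds_czf,
    fun _ => KripkeCZF.holds_separation, KripkeCZF.holds_neg_reflection_notDecEq,
    KripkeCZF.holds_notDecEq, KripkeCZF.holds_all_neg_relTo_notDecEq⟩
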